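/- A simple mixed graph $G$ consists of a finite non-empty vertex set $V=\{v_1,\dots,v_n\}$, a set of edges (unordered pairs of distinct vertices) and a set of arcs (ordered pairs of distinct vertices); an edge $\{u,v\}$ and the arcs $(u,v)$, $(v,u)$ may be present simultaneously. Write $d(u)$, $d^+(u)$, $d^-(u)$ for the number of edges at $u$, of arcs starting at $u$ and of arcs ending at $u$. $G$ is $r$-regular if $d^+(u)=d^-(u)$ and $d(u)+d^+(u)=r$ for every vertex $u$. Let $G_u$ be the undirected part of $G$ (all vertices, all edges, no arcs), let $A$ be its adjacency matrix, and let $D$ be the $0/1$ matrix with $D_{ij}=1$ if and only if $(v_i,v_j)$ is an arc. The integrated adjacency matrix of $G$ is the real symmetric $2n\times 2n$ matrix $$\mathcal I(G)=\begin{bmatrix}A & D\\ D^T & A\end{bmatrix},$$ and its eigenvalues are the $\mathcal I$-eigenvalues of $G$. A walk may traverse edges, and arcs in either direction; it is alternating if its successive arcs are traversed alternately forward and backward. A submixed graph $H$ of $G$ (a subset of the vertices, with a set of edges and a set of arcs of $G$ between them) having at least one arc is special if (a) any two distinct vertices of $H$ are joined by an alternating walk in $H$; and (b) whenever a component $K$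 of the undirected part $H_u$ contains a vertex at which an arc of $H$ ends and a vertex at which an arc of $H$ starts, every vertex $v$ of $K$ lies on a closed alternating walk in $H$ that starts and ends at $v$ and contains an odd number of arcs (counted with repetition). A mixed component of $G$ is a submixed graph that is: (Type I) a component of $G_u$ all of whose vertices have out-degree zero in $G$; or (Type II) a component of $G_u$ all of whose vertices have in-degree zero in $G$; or (Type III) a maximal special submixed graph of $G$. A component of $G_u$ that is both of Type I and of Type II is counted twice in the number of mixed components. **Theorem.** If $G$ is an $r$-regular simple mixed graph, then the largest $\mathcal I$-eigenvalue of $G$ equals $r$, and the multiplicity of $r$ as an $\mathcal I$-eigenvalue equals the number of mixed components of $G$. -/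

import Mathlib

/-- A simple mixed graph with vertex set `V`: undirected edges (the undirected part, a simple graph)
together with arcs, i.e. ordered pairs of distinct vertices. An edge `u ∼ v` and the arcs
`u → v`, `v → u` may all be present at the same time. -/
structure SimpleMixedGraph (V : Type*) where
  /-- the undirected part -/
  und : SimpleGraph V
  /-- `Arc u v` means `u → v` -/
  Arc : V → V → Prop
  arc_loopless : ∀ v, ¬ Arc v v

namespace SimpleMixedGraph

section Basic

variable {V : Type*} (G : SimpleMixedGraph V)

/-- The undirected degree `d(u)` (there are no loops). -/
noncomputable def undDegree (u : V) : ℕ := (G.und.neighborSet u).ncard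

/-- The out-degree `d⁺(u)`. -/
noncomputable def outDegree (u : V) : ℕ := {v | G.Arc u v}.ncard

/-- The in-degree `d⁻(u)`. -/
noncomputable def inDegree (u : V) : ℕ := {v | G.Arc v u}.ncard

/-- `r`-regular: `d⁺(u) = d⁻(u)` and `d(u) + d⁺(u) = r` for every vertex `u`. -/
def IsRegular (r : ℕ) : Prop :=
  ∀ u, G.outDegree u = G.inDegree u ∧ G.undDegree u + G.outDegree u = r

open Classical in
/-- The adjacency matrix of the directed part. -/
noncomputable def dirAdjMatrix : Matrix V V ℝ :=
  Matrix.of fun u v => if G.Arc u v then 1 else 0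

open Classical in
/-- The integrated adjacency matrix; `Sum.inl v` is the copy `v'` of `v` and `Sum.inr v` is the
copy `v''`. -/
noncomputable def integratedAdjMatrix : Matrix (V ⊕ V) (V ⊕ V) ℝ :=
  Matrix.fromBlocks (G.und.adjMatrix ℝ) G.dirAdjMatrix
    G.dirAdjMatrix.transpose (G.und.adjMatrix ℝ)

/-- The multiset of all eigenvalues of the (real symmetric) integrated adjacency matrix, with
multiplicities. -/
noncomputable def integratedSpectrum [Fintype V] [DecidableEq V] : Multiset ℝ :=
  G.integratedAdjMatrix.charpoly.roots

/-- A submixed graph of `G`: a set of vertices and a set of edges (a subgraph of the undirected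
part), together with a set of arcs of `G` whose ends are among the chosen vertices. -/
structure Submixed where
  und : G.und.Subgraph
  Arc : V → V → Prop
  arc_sub : ∀ {u v}, Arc u v → G.Arc u v
  tail_mem : ∀ {u v}, Arc u v → u ∈ und.verts
  head_mem : ∀ {u v}, Arc u v → v ∈ und.verts

end Basic

namespace Submixed

variable {V : Type*} {G : SimpleMixedGraph V}

/-- Inclusion of vertex sets, edge sets and arc sets. -/
instance : LE G.Submixed where
  le H K := H.und ≤ K.und ∧ ∀ u v, H.Arc u v → K.Arc u v

/-- Walks in a submixed graph: each step goes along an edge, along an arc in its direction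
(`fwd`), or along an arc against its direction (`bwd`). -/
inductive Walk (H : G.Submixed) : V → V → Type _
  | nil {v : V} (hv : v ∈ H.und.verts) : Walk H v v
  | edge {u v w : V} (h : H.und.Adj u v) (p : Walk H v w) : Walk H u w
  | fwd {u v w : V} (h : H.Arc u v) (p : Walk H v w) : Walk H u w
  | bwd {u v w : V} (h : H.Arc v u) (p : Walk H v w) : Walk H u w

/-- The directions in which a walk runs through its successive arcs: `true` is forward, `false` is
backward. Its length is the number of arcs in the walk, counted with repetition. -/
def Walk.arcDirs {H : G.Submixed} : {u v : V} → H.Walk u v → List Bool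
  | _, _, .nil _ => []
  | _, _, .edge _ p => p.arcDirs
  | _, _, .fwd _ p => true :: p.arcDirs
  | _, _, .bwd _ p => false :: p.arcDirs

/-- A walk is alternating if consecutive arcs in it are traversed in opposite directions. -/
def Walk.IsAlternating {H : G.Submixed} {u v : V} (p : H.Walk u v) : Prop :=
  p.arcDirs.IsChain (· ≠ ·)

/-- Special submixed graphs. -/
structure IsSpecial (H : G.Submixed) : Prop where
  exists_arc : ∃ u v, H.Arc u v
  joined : ∀ u ∈ H.und.verts, ∀ v ∈ H.und.verts, u ≠ v → ∃ p : H.Walk u v, p.IsAlternating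
  closed_odd : ∀ c : H.und.coe.ConnectedComponent,
    (∃ x ∈ c.supp, ∃ y, H.Arc y x) → (∃ x ∈ c.supp, ∃ y, H.Arc x y) →
      ∀ v ∈ c.supp, ∃ p : H.Walk (v : V) (v : V), p.IsAlternating ∧ Odd p.arcDirs.length

/-- `H` has no arcs and is a connected component of the undirected part of `G`. -/
def IsUndComponent (H : G.Submixed) : Prop :=
  (∀ u v, ¬ H.Arc u v) ∧ ∃ c : G.und.ConnectedComponent, H.und = c.toSubgraph

/-- Mixed components of Type I. -/
def IsTypeI (H : G.Submixed) : Prop :=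
  H.IsUndComponent ∧ ∀ u ∈ H.und.verts, G.outDegree u = 0

/-- Mixed components of Type II. -/
def IsTypeII (H : G.Submixed) : Prop :=
  H.IsUndComponent ∧ ∀ u ∈ H.und.verts, G.inDegree u = 0

/-- Mixed components of Type III: the maximal special submixed graphs. -/
def IsTypeIII (H : G.Submixed) : Prop :=
  Maximal IsSpecial H

end Submixed

/-- The number of mixed components of `G`. They form a multiset: a component without any arcs at
its vertices is of Type I and of Type II and is counted twice. -/
noncomputable def numMixedComponents {V : Type*} (G : SimpleMixedGraph V) : ℕ :=
  {H : G.Submixed | H.IsTypeI}.ncard + {H : G.Submixed | H.IsTypeII}.ncard +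
    {H : G.Submixed | H.IsTypeIII}.ncard

end SimpleMixedGraph

/-! The matrix `integratedAdjMatrix` is the adjacency matrix of an ordinary graph `cover` on two
copies of the vertex set: edges stay within a copy, and an arc joins the `true` copy of its tail to
the `false` copy of its head. Regularity of `G` makes the cover `r`-regular, so its adjacency matrix
is `r` minus its Laplacian. The Laplacian is positive semidefinite and its nullity is the number of
components, hence `r` is the largest eigenvalue and its multiplicity is the number of components of
the cover.

These components correspond to mixed components. Walks in the cover project to alternating walks and
alternating walks lift back, so the components that contain an arc project exactly onto the maximal
special submixed graphs (`isTypeIII_iff`). A component without arcs stays in one copy, where it is a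
component of the undirected part at which no arc starts (Type I) or none ends (Type II)
(`mem_image_arcFree_iff`). -/

namespace SimpleGraph

/-! ### Spectrum of a regular graph through its Laplacian. -/

variable {W : Type*} [Fintype W] [DecidableEq W] {Γ : SimpleGraph W} [DecidableRel Γ.Adj]

theorem IsRegularOfDegree.roots_charpoly_adjMatrix {r : ℕ}
    (h : Γ.IsRegularOfDegree r) :
    (Γ.adjMatrix ℝ).charpoly.roots =
      Multiset.map (fun i => (r : ℝ) - (Γ.isHermitian_lapMatrix ℝ).eigenvalues i)
        Finset.univ.val := by
  set hL := Γ.isHermitian_lapMatrix ℝ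
  set U := hL.eigenvectorUnitary
  have hA : Γ.adjMatrix ℝ = Unitary.conjStarAlgAut ℝ _ U
      (Matrix.diagonal fun i => (r : ℝ) - hL.eigenvalues i) := by
    have h1 : Γ.adjMatrix ℝ = (r : ℝ) • (1 : Matrix W W ℝ) - Γ.lapMatrix ℝ := by
      have : Γ.degMatrix ℝ = (r : ℝ) • (1 : Matrix W W ℝ) := by
        ext i j
        simp [degMatrix, Matrix.diagonal_apply, Matrix.one_apply, h.degree_eq]
      rw [lapMatrix, this, sub_sub_cancel]
    have h2 : (Matrix.diagonal fun i => (r : ℝ) - hL.eigenvalues i) =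
        (r : ℝ) • (1 : Matrix W W ℝ) - Matrix.diagonal (RCLike.ofReal ∘ hL.eigenvalues) := by
      ext i j
      by_cases hij : i = j <;> simp [hij]
    rw [h2, map_sub, map_smul, map_one, ← hL.spectral_theorem, h1]
  have hc : (Γ.adjMatrix ℝ).charpoly =
      ∏ i, (Polynomial.X - Polynomial.C ((r : ℝ) - hL.eigenvalues i)) := by
    rw [hA, Unitary.conjStarAlgAut_apply, Matrix.charpoly_mul_comm, ← mul_assoc]
    simp [Matrix.charpoly_diagonal]
  rw [hc, Polynomial.roots_prod]
  · simp only [Polynomial.roots_X_sub_C, Multiset.bind_singleton]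
  · simp only [Finset.prod_ne_zero_iff]
    exact fun i _ => Polynomial.X_sub_C_ne_zero _

theorem IsRegularOfDegree.le_of_mem_roots {r : ℕ}
    (h : Γ.IsRegularOfDegree r) {x : ℝ} (hx : x ∈ (Γ.adjMatrix ℝ).charpoly.roots) :
    x ≤ r := by
  rw [h.roots_charpoly_adjMatrix, Multiset.mem_map] at hx
  obtain ⟨i, -, rfl⟩ := hx
  have := (posSemidef_lapMatrix ℝ Γ).eigenvalues_nonneg i
  linarith

/-- The eigenvalue `r` corresponds to the Laplacian eigenvalue `0`, whose multiplicity is the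
nullity by rank–nullity, and the nullity counts components. -/
theorem IsRegularOfDegree.count_roots_charpoly_adjMatrix {r : ℕ} (h : Γ.IsRegularOfDegree r) :
    (Γ.adjMatrix ℝ).charpoly.roots.count (r : ℝ) = Nat.card Γ.ConnectedComponent := by
  classical
  rw [h.roots_charpoly_adjMatrix, Nat.card_eq_fintype_card,
    card_connectedComponent_eq_finrank_ker_toLin'_lapMatrix, Multiset.count_map]
  set hL := Γ.isHermitian_lapMatrix ℝ
  have h1 : Module.finrank ℝ (Γ.lapMatrix ℝ).toLin'.range =
      Fintype.card {i // hL.eigenvalues i ≠ 0} := hL.rank_eq_card_non_zero_eigs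
  have h2 := (Γ.lapMatrix ℝ).toLin'.finrank_range_add_finrank_ker
  rw [h1, Module.finrank_fintype_fun_eq_card] at h2
  have h3 := Finset.card_filter_add_card_filter_not (s := Finset.univ)
    (fun i => hL.eigenvalues i = 0)
  rw [Finset.card_univ] at h3
  have h4 : (Multiset.filter (fun a => (r : ℝ) = r - hL.eigenvalues a) Finset.univ.val).card =
      (Finset.univ.filter fun i => hL.eigenvalues i = 0).card := by
    rw [Finset.card_def, Finset.filter_val]
    congr 1
    refine Multiset.filter_congr fun i _ => ?_
    constructor <;> intro <;> linarith
  have h5 : Fintype.card {i // hL.eigenvalues i ≠ 0} =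
      (Finset.univ.filter fun i => ¬ hL.eigenvalues i = 0).card := by
    rw [Fintype.card_subtype]
  omega

end SimpleGraph

/-! ### The cover graph. -/

namespace SimpleMixedGraph

variable {V : Type*}

/-- The graph on two copies of the vertex set whose adjacency matrix is the integrated adjacency
matrix. -/
def cover (G : SimpleMixedGraph V) : SimpleGraph (V ⊕ V) where
  Adj
    | .inl u, .inl v => G.und.Adj u v
    | .inr u, .inr v => G.und.Adj u v
    | .inl u, .inr v => G.Arc u v
    | .inr u, .inl v => G.Arc v u
  symm := ⟨by
    rintro (u | u) (v | v) h
    exacts [SimpleGraph.Adj.symm h, h, h, SimpleGraph.Adj.symm h]⟩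
  loopless := ⟨by
    rintro (u | u) h
    exacts [G.und.irrefl h, G.und.irrefl h]⟩

/-- The copy of `v` in which arcs at `v` start (`true`) or end (`false`). -/
def copy : Bool → V → V ⊕ V
  | true, v => .inl v
  | false, v => .inr v

theorem exists_eq_copy (x : V ⊕ V) : ∃ b v, x = copy b v := by
  rcases x with v | v
  exacts [⟨true, v, rfl⟩, ⟨false, v, rfl⟩]

theorem copy_inj {b c : Bool} {u v : V} : copy b u = copy c v ↔ b = c ∧ u = v := by
  cases b <;> cases c <;> simp [copy]

/-- The step `u → v` of a walk along an arc in its direction (`true`) or against it (`false`). -/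
def ArcStep (A : V → V → Prop) : Bool → V → V → Prop
  | true, u, v => A u v
  | false, u, v => A v u

theorem ArcStep.symm {A : V → V → Prop} {b : Bool} {u v : V} (h : ArcStep A b u v) :
    ArcStep A (!b) v u := by
  cases b <;> exact h

theorem ArcStep.mono {A B : V → V → Prop} (hAB : ∀ u v, A u v → B u v) {b : Bool} {u v : V}
    (h : ArcStep A b u v) : ArcStep B b u v := by
  cases b <;> exact hAB _ _ h

variable (G : SimpleMixedGraph V)

@[simp]
theorem cover_adj_copy_self {b : Bool} {u v : V} :
    G.cover.Adj (copy b u) (copy b v) ↔ G.und.Adj u v := by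
  cases b <;> rfl

@[simp]
theorem cover_adj_copy_not {b : Bool} {u v : V} :
    G.cover.Adj (copy b u) (copy (!b) v) ↔ ArcStep G.Arc b u v := by
  cases b <;> rfl

theorem cover_adj_of_arc {G : SimpleMixedGraph V} {u v : V} (h : G.Arc u v) :
    G.cover.Adj (copy true u) (copy false v) :=
  h

/-- The undirected part of `G` embeds into the cover as either of the two copies. -/
def copyHom (b : Bool) : G.und →g G.cover where
  toFun := copy b
  map_rel' h := G.cover_adj_copy_self.2 h

variable {G}

theorem reachable_copy (b : Bool) {u v : V} (h : G.und.Reachable u v) :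
    G.cover.Reachable (copy b u) (copy b v) :=
  h.map (G.copyHom b)

/-- The cover changes copies only along arcs, so a walk cannot leave copy `b` if no usable arc
occurs on the undirected component. -/
theorem eq_copy_of_reachable {b : Bool} {u : V} {y : V ⊕ V}
    (h : G.cover.Reachable (copy b u) y)
    (hu : ∀ w, G.und.Reachable u w → ∀ v, ¬ ArcStep G.Arc b w v) :
    ∃ v, y = copy b v ∧ G.und.Reachable u v := by
  rw [SimpleGraph.reachable_iff_reflTransGen] at h
  induction h with
  | refl => exact ⟨u, rfl, .rfl⟩
  | @tail y z _ hyz ih =>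
    obtain ⟨v, rfl, hv⟩ := ih
    obtain ⟨c, w, rfl⟩ := exists_eq_copy z
    rcases eq_or_ne c b with rfl | hc
    · exact ⟨w, rfl, hv.trans (G.cover_adj_copy_self.1 hyz).reachable⟩
    · rw [Bool.eq_not_of_ne hc, cover_adj_copy_not] at hyz
      exact (hu v hv w hyz).elim

/-! ### Lifting walks of special submixed graphs to the cover. -/

namespace Submixed

variable {H : G.Submixed}

/-- Prepending `!b` to the directions says that the first arc, if any, has direction `b`, which is
the direction available in copy `b`. Each arc switches copies, so alternation is exactly what lets
the lift continue, and parity decides the final copy. -/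
theorem Walk.reachable_cover {u v : V} (p : H.Walk u v) :
    ∀ b, ((!b) :: p.arcDirs).IsChain (· ≠ ·) →
      G.cover.Reachable (copy b u) (copy (b ^^ p.arcDirs.length.bodd) v) := by
  induction p with
  | nil hv => intro b _; simp [arcDirs]
  | edge h p ih =>
    intro b hb
    exact (G.cover_adj_copy_self.2 h.adj_sub).reachable.trans (ih b hb)
  | fwd h p ih =>
    intro b hb
    simp only [arcDirs, List.isChain_cons_cons] at hb
    obtain rfl : b = true := by simpa using hb.1
    have := ih false hb.2
    refine (cover_adj_of_arc (H.arc_sub h)).reachable.trans ?_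
    simpa [arcDirs, Nat.bodd_succ] using this
  | bwd h p ih =>
    intro b hb
    simp only [arcDirs, List.isChain_cons_cons] at hb
    obtain rfl : b = false := by simpa using hb.1
    have := ih true hb.2
    refine (cover_adj_of_arc (H.arc_sub h)).symm.reachable.trans ?_
    simpa [arcDirs, Nat.bodd_succ] using this

theorem Walk.IsAlternating.exists_isChain_cons {u v : V} {p : H.Walk u v}
    (hp : p.IsAlternating) : ∃ b : Bool, ((!b) :: p.arcDirs).IsChain (· ≠ ·) := by
  unfold Walk.IsAlternating at hp
  cases h : p.arcDirs with
  -- Without arcs the walk lifts to either copy; `true` is an arbitrary choice.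
  | nil => exact ⟨true, .singleton _⟩
  | cons d l =>
    rw [h] at hp
    exact ⟨d, .cons_cons (by simp) hp⟩

theorem Walk.IsAlternating.reachable_of_odd {v : V} {p : H.Walk v v} (hp : p.IsAlternating)
    (ho : Odd p.arcDirs.length) (b c : Bool) :
    G.cover.Reachable (copy b v) (copy c v) := by
  have key : G.cover.Reachable (copy true v) (copy false v) := by
    obtain ⟨d, hd⟩ := hp.exists_isChain_cons
    have := p.reachable_cover d hd
    rw [Nat.odd_iff, Nat.mod_two_of_bodd] at ho
    rw [show p.arcDirs.length.bodd = true by simpa using ho] at this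
    cases d
    · exact this.symm
    · exact this
  cases b <;> cases c
  exacts [.rfl, key.symm, key, .rfl]

/-- The copy `b` of `u` is live in `H` if the component of `u` in the undirected part of `H` has a
vertex at which an arc of `H` starts (`b = true`) or ends (`b = false`). -/
def IsLive (H : G.Submixed) (b : Bool) (u : H.und.verts) : Prop :=
  ∃ w, H.und.coe.Reachable u w ∧ ∃ y, ArcStep H.Arc b w y

/-- This is the role of condition (b): when both copies are live, the odd closed walk lifts to a
path between them. -/
theorem IsSpecial.reachable_of_isLive (hH : H.IsSpecial) {u : H.und.verts} {b c : Bool}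
    (hb : H.IsLive b u) (hc : H.IsLive c u) :
    G.cover.Reachable (copy b (u : V)) (copy c (u : V)) := by
  have key : ∀ {u : H.und.verts}, H.IsLive true u → H.IsLive false u → ∀ b c : Bool,
      G.cover.Reachable (copy b (u : V)) (copy c (u : V)) := by
    rintro u ⟨w, hw, y, hy⟩ ⟨w', hw', y', hy'⟩ b c
    obtain ⟨p, hp, ho⟩ := hH.closed_odd (H.und.coe.connectedComponentMk u)
      ⟨w', SimpleGraph.ConnectedComponent.sound hw'.symm, y', hy'⟩
      ⟨w, SimpleGraph.ConnectedComponent.sound hw.symm, y, hy⟩ u rfl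
    exact hp.reachable_of_odd ho b c
  cases b <;> cases c
  exacts [.rfl, key hc hb _ _, key hb hc _ _, .rfl]

theorem IsLive.congr {u v : H.und.verts} (h : H.und.coe.Reachable u v) {b : Bool}
    (hu : H.IsLive b u) : H.IsLive b v := by
  obtain ⟨w, hw, hy⟩ := hu
  exact ⟨w, h.symm.trans hw, hy⟩

theorem arcStep_mem {b : Bool} {u v : V} (h : ArcStep H.Arc b u v) :
    u ∈ H.und.verts ∧ v ∈ H.und.verts := by
  cases b
  exacts [⟨H.head_mem h, H.tail_mem h⟩, ⟨H.tail_mem h, H.head_mem h⟩]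

theorem IsSpecial.exists_isLive_of_arcStep (hH : H.IsSpecial) {u v : V} {b c : Bool}
    (h : ArcStep H.Arc c u v) (hu : u ∈ H.und.verts) (hl : H.IsLive b ⟨u, hu⟩) :
    ∃ hv : v ∈ H.und.verts, H.IsLive (!c) ⟨v, hv⟩ ∧
      G.cover.Reachable (copy b u) (copy (!c) v) := by
  refine ⟨(arcStep_mem h).2, ⟨⟨v, _⟩, .rfl, u, h.symm⟩, ?_⟩
  exact (hH.reachable_of_isLive hl ⟨⟨u, hu⟩, .rfl, v, h⟩).trans
    (G.cover_adj_copy_not.2 (h.mono fun _ _ => H.arc_sub)).reachable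

/-- Alternation is not needed here: before each arc one may move to the copy from which that arc is
traversed, since live copies of the same vertex are joined in the cover. -/
theorem IsSpecial.exists_isLive_of_walk (hH : H.IsSpecial) {u v : V} (p : H.Walk u v) :
    ∀ (hu : u ∈ H.und.verts) (b : Bool), H.IsLive b ⟨u, hu⟩ →
      ∃ (hv : v ∈ H.und.verts) (c : Bool), H.IsLive c ⟨v, hv⟩ ∧
        G.cover.Reachable (copy b u) (copy c v) := by
  induction p with
  | nil hv => exact fun hu b hl => ⟨hu, b, hl, .rfl⟩
  | @edge u v w h p ih =>
    intro hu b hl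
    have hadj : H.und.coe.Adj ⟨u, hu⟩ ⟨v, h.snd_mem⟩ := h
    obtain ⟨hw, c, hc, hr⟩ := ih h.snd_mem b (hl.congr hadj.reachable)
    exact ⟨hw, c, hc, (reachable_copy b h.adj_sub.reachable).trans hr⟩
  | fwd h p ih =>
    intro hu b hl
    obtain ⟨hv, hl', hr'⟩ := hH.exists_isLive_of_arcStep (c := true) h hu hl
    obtain ⟨hw, c, hc, hr⟩ := ih hv _ hl'
    exact ⟨hw, c, hc, hr'.trans hr⟩
  | bwd h p ih =>
    intro hu b hl
    obtain ⟨hv, hl', hr'⟩ := hH.exists_isLive_of_arcStep (c := false) h hu hl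
    obtain ⟨hw, c, hc, hr⟩ := ih hv _ hl'
    exact ⟨hw, c, hc, hr'.trans hr⟩

/-! ### Projections of cover components are the Type III components. -/

/-- The projection of a component of the cover. -/
def ofComponent (C : G.cover.ConnectedComponent) : G.Submixed where
  und := (⊤ : G.und.Subgraph).induce {v | ∃ b, G.cover.connectedComponentMk (copy b v) = C}
  Arc u v := G.Arc u v ∧ G.cover.connectedComponentMk (copy true u) = C
  arc_sub h := h.1
  tail_mem h := ⟨true, h.2⟩
  head_mem {u v} h := ⟨false, by
    rw [← h.2, eq_comm]
    exact SimpleGraph.ConnectedComponent.sound (cover_adj_of_arc h.1).reachable⟩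

theorem arcStep_ofComponent {C : G.cover.ConnectedComponent} {b : Bool} {u v : V} :
    ArcStep (ofComponent C).Arc b u v ↔
      ArcStep G.Arc b u v ∧ G.cover.connectedComponentMk (copy b u) = C := by
  cases b
  · refine and_congr_right fun h => ?_
    rw [SimpleGraph.ConnectedComponent.connectedComponentMk_eq_of_adj (cover_adj_of_arc h)]
  · rfl

/-- Converse to `Walk.reachable_cover`: crossings between the copies necessarily go to and fro, so
the projected walk alternates. -/
theorem exists_walk_ofComponent {C : G.cover.ConnectedComponent} {x y : V ⊕ V}
    (p : G.cover.Walk x y) : ∀ b u c v, x = copy b u → y = copy c v →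
      G.cover.connectedComponentMk x = C →
      ∃ q : (ofComponent C).Walk u v, ((!b) :: q.arcDirs).IsChain (· ≠ ·) ∧
        c = (b ^^ q.arcDirs.length.bodd) := by
  induction p with
  | nil =>
    rintro b u c v rfl h hC
    obtain ⟨rfl, rfl⟩ := copy_inj.1 h
    exact ⟨.nil ⟨b, hC⟩, .singleton _, by simp [Walk.arcDirs]⟩
  | @cons x y z hxy p ih =>
    rintro b u c v rfl rfl hC
    obtain ⟨d, w, rfl⟩ := exists_eq_copy y
    have hC' := hC
    rw [SimpleGraph.ConnectedComponent.connectedComponentMk_eq_of_adj hxy] at hC'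
    obtain ⟨q, hq, hl⟩ := ih d w c v rfl rfl hC'
    rcases eq_or_ne d b with rfl | hd
    · exact ⟨.edge ⟨⟨d, hC⟩, ⟨d, hC'⟩, G.cover_adj_copy_self.1 hxy⟩ q, hq, hl⟩
    · obtain rfl := Bool.eq_not_of_ne hd
      have hs : ArcStep (ofComponent C).Arc b u w :=
        arcStep_ofComponent.2 ⟨G.cover_adj_copy_not.1 hxy, hC⟩
      cases b
      · exact ⟨.bwd hs q, .cons_cons (by simp) hq, by simp [Walk.arcDirs, hl]⟩
      · exact ⟨.fwd hs q, .cons_cons (by simp) hq, by simp [Walk.arcDirs, hl]⟩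

theorem isSpecial_ofComponent {C : G.cover.ConnectedComponent}
    (h : ∃ u v, (ofComponent C).Arc u v) : (ofComponent C).IsSpecial where
  exists_arc := h
  joined := by
    rintro u ⟨b, hu⟩ v ⟨c, hv⟩ -
    obtain ⟨p⟩ := SimpleGraph.ConnectedComponent.exact (hu.trans hv.symm)
    obtain ⟨q, hq, -⟩ := exists_walk_ofComponent p b u c v rfl rfl hu
    exact ⟨q, hq.tail⟩
  closed_odd := by
    rintro c ⟨x, hx, x', hxa⟩ ⟨y, hy, y', hya⟩ v hv
    have hr : ∀ {z}, z ∈ c.supp → ∀ b, G.cover.connectedComponentMk (copy b (v : V)) =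
        G.cover.connectedComponentMk (copy b (z : V)) := by
      intro z hz b
      have := SimpleGraph.ConnectedComponent.exact (hv.trans hz.symm)
      exact SimpleGraph.ConnectedComponent.sound
        (reachable_copy b (this.map (ofComponent C).und.hom))
    have h1 := (hr hx false).trans (arcStep_ofComponent (b := false).1 hxa).2
    have h2 := (hr hy true).trans (arcStep_ofComponent (b := true).1 hya).2
    -- Both copies of `v` lie in `C`; a path between them changes copies an odd number of times.
    obtain ⟨p⟩ := SimpleGraph.ConnectedComponent.exact (h2.trans h1.symm)
    obtain ⟨q, hq, ho⟩ := exists_walk_ofComponent p true v false v rfl rfl h2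
    refine ⟨q, hq.tail, ?_⟩
    rw [← Nat.not_even_iff_odd]
    rintro ⟨k, hk⟩
    simp [hk] at ho

/-- All live copies of vertices of `H` lie in the cover component of the tail of one chosen arc. -/
theorem IsSpecial.exists_le_ofComponent (hH : H.IsSpecial) :
    ∃ C, (∃ u v, (ofComponent C).Arc u v) ∧ H ≤ ofComponent C := by
  obtain ⟨a, a', ha⟩ := hH.exists_arc
  have hlive : H.IsLive true ⟨a, H.tail_mem ha⟩ := ⟨_, .rfl, a', ha⟩
  have key : ∀ v (hv : v ∈ H.und.verts), ∃ c, H.IsLive c ⟨v, hv⟩ ∧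
      G.cover.Reachable (copy true a) (copy c v) := by
    intro v hv
    by_cases hav : a = v
    · subst hav
      exact ⟨true, hlive, .rfl⟩
    · obtain ⟨p, -⟩ := hH.joined a (H.tail_mem ha) v hv hav
      obtain ⟨_, c, hc⟩ := hH.exists_isLive_of_walk p _ _ hlive
      exact ⟨c, hc⟩
  have hverts : ∀ v ∈ H.und.verts, v ∈
      (ofComponent (G.cover.connectedComponentMk (copy true a))).und.verts := by
    intro v hv
    obtain ⟨c, -, hr⟩ := key v hv
    exact ⟨c, SimpleGraph.ConnectedComponent.sound hr.symm⟩
  refine ⟨G.cover.connectedComponentMk (copy true a), ⟨a, a', H.arc_sub ha, rfl⟩,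
    ⟨hverts, fun u v h => ⟨hverts u h.fst_mem, hverts v h.snd_mem, h.adj_sub⟩⟩, fun u v h => ?_⟩
  obtain ⟨c, hc, hr⟩ := key u (H.tail_mem h)
  exact ⟨H.arc_sub h, SimpleGraph.ConnectedComponent.sound
    (hr.trans (hH.reachable_of_isLive (c := true) hc ⟨_, .rfl, v, h⟩)).symm⟩

theorem eq_of_le_of_le {K : G.Submixed} (h : H ≤ K) (h' : K ≤ H) : H = K := by
  cases H
  cases K
  obtain ⟨h1, h2⟩ := h
  obtain ⟨h1', h2'⟩ := h'
  obtain rfl := le_antisymm h1 h1'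
  congr
  funext u v
  exact propext ⟨h2 u v, h2' u v⟩

/-- An arc determines its cover component through the `true` copy of its tail. -/
theorem eq_of_ofComponent_le {C D : G.cover.ConnectedComponent}
    (hC : ∃ u v, (ofComponent C).Arc u v) (h : ofComponent C ≤ ofComponent D) : C = D := by
  obtain ⟨u, v, huv⟩ := hC
  exact huv.2.symm.trans (h.2 u v huv).2

/-- Every special submixed graph lies below a projection with arcs; these projections are themselves
special and pairwise incomparable, so they are exactly the maximal ones. -/
theorem isTypeIII_iff {H : G.Submixed} :
    H.IsTypeIII ↔ ∃ C, (∃ u v, (ofComponent C).Arc u v) ∧ ofComponent C = H := by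
  constructor
  · intro h
    obtain ⟨C, hC, hle⟩ := h.prop.exists_le_ofComponent
    exact ⟨C, hC, eq_of_le_of_le (h.2 (isSpecial_ofComponent hC) hle) hle⟩
  · rintro ⟨C, hC, rfl⟩
    refine ⟨isSpecial_ofComponent hC, fun K hK hle => ?_⟩
    obtain ⟨D, hD, hKD⟩ := hK.exists_le_ofComponent
    have : ofComponent C ≤ ofComponent D :=
      ⟨hle.1.trans hKD.1, fun u v h => hKD.2 u v (hle.2 u v h)⟩
    rwa [eq_of_ofComponent_le hC this]

theorem ncard_isTypeIII : {H : G.Submixed | H.IsTypeIII}.ncard =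
    {C : G.cover.ConnectedComponent | ∃ u v, (ofComponent C).Arc u v}.ncard := by
  have : {H : G.Submixed | H.IsTypeIII} =
      ofComponent '' {C : G.cover.ConnectedComponent | ∃ u v, (ofComponent C).Arc u v} :=
    Set.ext fun _ => isTypeIII_iff
  rw [this, Set.InjOn.ncard_image]
  intro C hC D _ h
  exact eq_of_ofComponent_le hC ⟨h ▸ le_rfl, fun u v huv => h ▸ huv⟩

/-! ### Arc-free components and the total count. -/

/-- The components of the undirected part of `G` at which no arc starts (`b = true`) or ends
(`b = false`). -/
def arcFree (G : SimpleMixedGraph V) (b : Bool) : Set G.und.ConnectedComponent :=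
  {c | ∀ u ∈ c.supp, ∀ v, ¬ ArcStep G.Arc b u v}

theorem ncard_isUndComponent (b : Bool) :
    {H : G.Submixed | H.IsUndComponent ∧ ∀ u ∈ H.und.verts, ∀ v, ¬ ArcStep G.Arc b u v}.ncard =
      (arcFree G b).ncard := by
  let f : G.und.ConnectedComponent → G.Submixed := fun c =>
    { und := c.toSubgraph
      Arc := fun _ _ => False
      arc_sub := False.elim
      tail_mem := False.elim
      head_mem := False.elim }
  have hf : f.Injective := fun c d h =>
    SimpleGraph.ConnectedComponent.supp_injective (congrArg (fun H => H.und.verts) h)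
  rw [← Set.ncard_image_of_injective _ hf]
  congr 1
  ext H
  constructor
  · rintro ⟨⟨h1, c, hc⟩, h2⟩
    refine ⟨c, fun u hu => h2 u (hc ▸ hu), eq_of_le_of_le ⟨hc ▸ le_rfl, fun _ _ => False.elim⟩
      ⟨hc ▸ le_rfl, fun u v h => h1 u v h⟩⟩
  · rintro ⟨c, hc, rfl⟩
    exact ⟨⟨fun _ _ => id, c, rfl⟩, hc⟩

theorem injOn_map_copyHom (b : Bool) :
    Set.InjOn (SimpleGraph.ConnectedComponent.map (G.copyHom b)) (arcFree G b) := by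
  intro c hc d _ h
  induction c using SimpleGraph.ConnectedComponent.ind with | _ u =>
  induction d using SimpleGraph.ConnectedComponent.ind with | _ v =>
  obtain ⟨w, hw, hr⟩ := eq_copy_of_reachable (SimpleGraph.ConnectedComponent.exact h)
    fun w hw => hc w (SimpleGraph.ConnectedComponent.sound hw.symm)
  obtain rfl := (copy_inj.1 hw).2
  exact SimpleGraph.ConnectedComponent.sound hr

/-- A cover component without arcs that meets copy `b` cannot leave it, so it is a copy of a single
undirected component. -/
theorem mem_image_arcFree_iff {b : Bool} {C : G.cover.ConnectedComponent} :
    C ∈ SimpleGraph.ConnectedComponent.map (G.copyHom b) '' arcFree G b ↔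
      (∃ u, G.cover.connectedComponentMk (copy b u) = C) ∧
        ¬ ∃ u v, (ofComponent C).Arc u v := by
  constructor
  · rintro ⟨c, hc, rfl⟩
    induction c using SimpleGraph.ConnectedComponent.ind with | _ u =>
    refine ⟨⟨u, rfl⟩, ?_⟩
    rintro ⟨v, w, h⟩
    have hs : ∃ v w, ArcStep (ofComponent (SimpleGraph.ConnectedComponent.map (G.copyHom b)
        (G.und.connectedComponentMk u))).Arc b v w := by
      cases b
      exacts [⟨w, v, h⟩, ⟨v, w, h⟩]
    obtain ⟨v, w, h⟩ := hs
    obtain ⟨h, h'⟩ := arcStep_ofComponent.1 h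
    obtain ⟨v', hv', hr⟩ := eq_copy_of_reachable (SimpleGraph.ConnectedComponent.exact h'.symm)
      fun w hw => hc w (SimpleGraph.ConnectedComponent.sound hw.symm)
    obtain rfl := (copy_inj.1 hv').2
    exact hc v (SimpleGraph.ConnectedComponent.sound hr.symm) w h
  · rintro ⟨⟨u, rfl⟩, h⟩
    refine ⟨G.und.connectedComponentMk u, fun w hw v hs => h ?_, rfl⟩
    have := arcStep_ofComponent.2 ⟨hs, SimpleGraph.ConnectedComponent.sound
      (reachable_copy b (SimpleGraph.ConnectedComponent.exact hw))⟩
    cases b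
    exacts [⟨v, w, this⟩, ⟨w, v, this⟩]

end Submixed

open Submixed in
-- An undirected component with no arcs at all has two separate lifts, one in each copy; this is why
-- it is counted twice.
theorem card_connectedComponent_cover [Finite V] :
    Nat.card G.cover.ConnectedComponent =
      (arcFree G true).ncard + (arcFree G false).ncard +
        {C : G.cover.ConnectedComponent | ∃ u v, (ofComponent C).Arc u v}.ncard := by
  set S := {C : G.cover.ConnectedComponent | ∃ u v, (ofComponent C).Arc u v}
  rw [← (injOn_map_copyHom true).ncard_image,
    ← (injOn_map_copyHom false).ncard_image, ← Set.ncard_union_eq,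
    ← Set.ncard_union_eq, ← Set.ncard_univ]
  · congr 1
    symm
    rw [Set.eq_univ_iff_forall]
    intro C
    by_cases hC : C ∈ S
    · exact Or.inr hC
    · left
      induction C using SimpleGraph.ConnectedComponent.ind with | _ x =>
      obtain ⟨b, v, rfl⟩ := exists_eq_copy x
      have := mem_image_arcFree_iff.2 ⟨⟨v, rfl⟩, hC⟩
      cases b
      exacts [Or.inr this, Or.inl this]
  · rw [Set.disjoint_left]
    rintro C (hC | hC) <;> exact (mem_image_arcFree_iff.1 hC).2
  · rw [Set.disjoint_left]
    rintro _ ⟨c, hc, rfl⟩ hC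
    induction c using SimpleGraph.ConnectedComponent.ind with | _ u =>
    obtain ⟨⟨v, hv⟩, -⟩ := mem_image_arcFree_iff.1 hC
    obtain ⟨w, hw, -⟩ := eq_copy_of_reachable (b := true) (u := u)
      (SimpleGraph.ConnectedComponent.exact hv.symm) fun w hw => hc w (SimpleGraph.ConnectedComponent.sound hw.symm)
    simp [copy_inj] at hw

theorem outDegree_eq_zero_iff [Finite V] {u : V} :
    G.outDegree u = 0 ↔ ∀ v, ¬ ArcStep G.Arc true u v := by
  rw [outDegree, Set.ncard_eq_zero, Set.eq_empty_iff_forall_notMem]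
  rfl

theorem inDegree_eq_zero_iff [Finite V] {u : V} :
    G.inDegree u = 0 ↔ ∀ v, ¬ ArcStep G.Arc false u v := by
  rw [inDegree, Set.ncard_eq_zero, Set.eq_empty_iff_forall_notMem]
  rfl

theorem numMixedComponents_eq_card [Finite V] :
    G.numMixedComponents = Nat.card G.cover.ConnectedComponent := by
  rw [card_connectedComponent_cover, ← Submixed.ncard_isTypeIII,
    ← Submixed.ncard_isUndComponent, ← Submixed.ncard_isUndComponent]
  simp only [numMixedComponents, Submixed.IsTypeI, Submixed.IsTypeII, outDegree_eq_zero_iff,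
    inDegree_eq_zero_iff]

open Classical in
theorem adjMatrix_cover : G.cover.adjMatrix ℝ = G.integratedAdjMatrix := by
  ext (u | u) (v | v) <;> rw [SimpleGraph.adjMatrix_apply] <;>
    simp [integratedAdjMatrix, dirAdjMatrix, SimpleGraph.adjMatrix_apply, cover] <;>
    congr

/-- The `true` copy of `u` has degree `d(u) + d⁺(u)` and the `false` copy `d(u) + d⁻(u)`; the
balance condition makes both equal to `r`. -/
theorem IsRegular.ncard_neighborSet_cover [Finite V] {r : ℕ} (hG : G.IsRegular r) (x : V ⊕ V) :
    (G.cover.neighborSet x).ncard = r := by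
  obtain ⟨b, u, rfl⟩ := exists_eq_copy x
  have hset : G.cover.neighborSet (copy b u) =
      copy b '' G.und.neighborSet u ∪ copy (!b) '' {v | ArcStep G.Arc b u v} := by
    ext y
    obtain ⟨c, v, rfl⟩ := exists_eq_copy y
    rcases eq_or_ne c b with rfl | hc
    · simp [copy_inj]
    · obtain rfl := Bool.eq_not_of_ne hc
      simp [copy_inj]
  have hinj : ∀ b, (copy b : V → V ⊕ V).Injective := fun b u v h => (copy_inj.1 h).2
  rw [hset, Set.ncard_union_eq, Set.ncard_image_of_injective _ (hinj _),
    Set.ncard_image_of_injective _ (hinj _)]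
  · obtain ⟨h1, h2⟩ := hG u
    cases b
    · rw [h1] at h2
      exact h2
    · exact h2
  · rw [Set.disjoint_left]
    rintro _ ⟨v, -, rfl⟩ ⟨w, -, h⟩
    simp [copy_inj] at h

open Classical in
theorem IsRegular.isRegularOfDegree_cover [Fintype V] {r : ℕ} (hG : G.IsRegular r) :
    G.cover.IsRegularOfDegree r := by
  intro x
  rw [← hG.ncard_neighborSet_cover x, ← SimpleGraph.card_neighborSet_eq_degree,
    ← Nat.card_eq_fintype_card, Nat.card_coe_set_eq]

end SimpleMixedGraph

theorem mainTheorem4 {V : Type*} [Fintype V] [DecidableEq V] [Nonempty V]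
    (G : SimpleMixedGraph V) (r : ℕ) (hG : G.IsRegular r) :
    IsGreatest {x : ℝ | x ∈ G.integratedSpectrum} (r : ℝ) ∧
      G.integratedSpectrum.count (r : ℝ) = G.numMixedComponents := by
  classical
  have hreg := hG.isRegularOfDegree_cover
  have hspec : G.integratedSpectrum = (G.cover.adjMatrix ℝ).charpoly.roots := by
    rw [SimpleMixedGraph.adjMatrix_cover, SimpleMixedGraph.integratedSpectrum]
  have hcount : G.integratedSpectrum.count (r : ℝ) = G.numMixedComponents := by
    rw [SimpleMixedGraph.numMixedComponents_eq_card, hspec]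
    convert hreg.count_roots_charpoly_adjMatrix
  refine ⟨⟨?_, fun x hx => ?_⟩, hcount⟩
  -- That `r` is an eigenvalue follows from its multiplicity: the cover of a nonempty graph has a
  -- component.
  · refine Multiset.count_pos.1 ?_
    rw [hcount, SimpleMixedGraph.numMixedComponents_eq_card]
    have : Nonempty G.cover.ConnectedComponent :=
      ⟨G.cover.connectedComponentMk (.inl (Classical.arbitrary V))⟩
    exact Nat.card_pos
  · refine hreg.le_of_mem_roots ?_
    rw [Set.mem_ofPred_eq, hspec] at hx
    convert hx
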